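/- For a finite graph $H$ with at least three vertices let $$m_2(H)=\max_{H'\subseteq H,\ v(H')\ge 3}\frac{e(H')-1}{v(H')-2},$$ where $v$ and $e$ count vertices and edges. For graphs $G,T,H$ let $ex(G,T,H)$ be the maximum number of (not necessarily induced, unlabelled) copies of $T$ in an $H$-free subgraph of $G$. Let $G(n,p)$ be the binomial random graph on $n$ vertices in which each edge is present independently with probability $p$. **Theorem 1.4.** Let $m\ge 3$ be an integer and let $c<m_2(K_m)$ be real. There are $M=M(m,c)\in\mathbb N$ and $\delta=\delta(m,c)>0$ such that the following holds. Let $H$ be a finite graph with $\chi(H)=m+1$ and $m_2(H)<c$ which has a subgraph $H_0\subseteq H$ with $\frac{e(H_0)-1}{v(H_0)-2}=m_2(H)$ and $v(H_0)>M$. Let $p=p(n)\in[0,1]$ satisfy $p\le n^{-\frac1{m_2(H)}+\delta}$ for all sufficiently large $n$ and $\binom nm p^{\binom m2}\to\infty$ as $n\to\infty$. Then, w.h.p., $$ex(G(n,p),K_m,H)=(1+o(1))\binom nm p^{\binom m2},$$ that is, for every $\varepsilon>0$ the probability that $\left|ex(G(n,p),K_m,H)-\binom nm p^{\binom m2}\right|\le\varepsilon\binom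 nm p^{\binom m2}$ tends to $1$ as $n\to\infty$. -/

import Mathlib

open Filter Topology MeasureTheory

noncomputable section

namespace RandomTuran

/-- The set of values `(e(H') - 1) / (v(H') - 2)` over the (not necessarily induced) subgraphs `H'`
of `H` with at least three vertices. -/
def twoDensityValues {V : Type*} (H : SimpleGraph V) : Set ℝ :=
  {x | ∃ H' : H.Subgraph, 3 ≤ H'.verts.ncard ∧
    x = ((H'.edgeSet.ncard : ℝ) - 1) / ((H'.verts.ncard : ℝ) - 2)}

/-- The 2-density `m₂(H)`, the maximum of `(e(H') - 1) / (v(H') - 2)` over all subgraphs `H'` of `H`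
with at least three vertices. For finite `H` with at least three vertices this maximum is attained,
see `isGreatest_twoDensity`. -/
def twoDensity {V : Type*} (H : SimpleGraph V) : ℝ :=
  sSup (twoDensityValues H)

theorem isGreatest_twoDensity {V : Type*} [Fintype V] (H : SimpleGraph V)
    (hV : 3 ≤ Fintype.card V) : IsGreatest (twoDensityValues H) (twoDensity H) := by
  have hfin : (twoDensityValues H).Finite := by
    refine (Set.finite_range fun H' : H.Subgraph =>
      ((H'.edgeSet.ncard : ℝ) - 1) / ((H'.verts.ncard : ℝ) - 2)).subset ?_
    rintro x ⟨H', -, rfl⟩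
    exact ⟨H', rfl⟩
  have hne : (twoDensityValues H).Nonempty :=
    ⟨_, ⊤, by simpa [Set.ncard_univ, Nat.card_eq_fintype_card] using hV, rfl⟩
  exact ⟨hne.csSup_mem hfin, fun x hx => le_csSup hfin.bddAbove hx⟩

open Classical in
/-- `ex(G, T, H)`: the maximum number of (unlabelled, not necessarily induced) copies of `T` in an
`H`-free subgraph of `G`. Removing vertices never creates copies, so spanning subgraphs `G' ≤ G`
suffice. -/
def maxCopies {U W V : Type*} [Fintype U] (G : SimpleGraph U) (T : SimpleGraph W)
    (H : SimpleGraph V) : ℕ :=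
  (Finset.univ.filter fun G' : SimpleGraph U => G' ≤ G ∧ H.Free G').sup fun G' => G'.copyCount T

/-- `X(G(n, p)) = (1 + o(1)) f(n)` with high probability, where `p = p(n)`: for each `ε > 0`, the
probability that `|X(G) - f(n)| ≤ ε f(n)` for `G ∼ G(n, p(n))` tends to `1`. -/
def WhpAsymp (p : ℕ → unitInterval) (X : ∀ n : ℕ, SimpleGraph (Fin n) → ℝ) (f : ℕ → ℝ) : Prop :=
  ∀ ε : ℝ, 0 < ε →
    Tendsto (fun n : ℕ => (SimpleGraph.binomialRandom (Fin n) (p n)).real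
      {G : SimpleGraph (Fin n) | |X n G - f n| ≤ ε * f n}) atTop (𝓝 1)

end RandomTuran

end

/-! Keep exactly the edges of `G(n, p)` that lie in `m`-cliques. This loses no clique, and the
number of `m`-cliques is concentrated by Chebyshev's inequality, so it is enough that the resulting
graph is `H`-free with high probability.

A copy of `H` in it puts each edge of `H₀` inside an `m`-clique of `G(n, p)`. Write `f_y = v - y e`,
which is submodular on edge sets. For `y₀ = 1 / m₂(K_m) = 2 / (m + 1)`, an `m`-clique and a single
edge have the same `f_{y₀}`, and no nonempty set of edges of the clique has less; hence cliques
glued along edges form clusters with `f_{y₀} ≤ 2 - y₀`. Since `1 / m₂(H) > 1 / c > y₀`, adding a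
cluster to the copy of `H₀` lowers `f_y`, for `y` close to `1 / m₂(H)`, by an amount proportional to
the number of edges of `H₀` it covers. As `f_y` is bounded on `H₀` apart from an error `δ e(H₀)`,
a large `H₀` forces a subgraph of bounded size with `f_y ≤ -1`, and the first moment method rules
such subgraphs out. -/

namespace RandomTuran

section EdgeSets

variable {α β : Type*} [DecidableEq α] [DecidableEq β]

/-- The vertex set of the graph without isolated vertices whose edge set is `A`. -/
def endpoints (A : Finset (Sym2 α)) : Finset α := A.biUnion Sym2.toFinset

/-- The edge set of the complete graph on `S`. -/
def completeEdges (S : Finset α) : Finset (Sym2 α) := S.sym2.filter fun e => ¬ e.IsDiag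

theorem mem_endpoints {A : Finset (Sym2 α)} {v : α} : v ∈ endpoints A ↔ ∃ e ∈ A, v ∈ e := by
  simp [endpoints]

theorem endpoints_mono {A B : Finset (Sym2 α)} (h : A ⊆ B) : endpoints A ⊆ endpoints B :=
  Finset.biUnion_subset_biUnion_of_subset_left _ h

theorem endpoints_union (A B : Finset (Sym2 α)) :
    endpoints (A ∪ B) = endpoints A ∪ endpoints B := Finset.union_biUnion

theorem endpoints_image (f : β → α) (A : Finset (Sym2 β)) :
    endpoints (A.image (Sym2.map f)) = (endpoints A).image f := by
  ext v
  simp only [mem_endpoints, Finset.mem_image, exists_exists_and_eq_and, Sym2.mem_map]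
  grind

theorem card_endpoints_le (A : Finset (Sym2 α)) : (endpoints A).card ≤ A.card * 2 :=
  Finset.card_biUnion_le_card_mul _ _ _ fun e _ => by
    rw [Sym2.card_toFinset]
    split_ifs <;> norm_num

theorem two_le_card_endpoints {A : Finset (Sym2 α)} (hA : A.Nonempty)
    (hd : ∀ e ∈ A, ¬ e.IsDiag) : 2 ≤ (endpoints A).card := by
  obtain ⟨e, he⟩ := hA
  rw [← Sym2.card_toFinset_of_not_isDiag e (hd e he)]
  exact Finset.card_le_card (Finset.subset_biUnion_of_mem Sym2.toFinset he)

theorem mem_completeEdges {S : Finset α} {e : Sym2 α} :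
    e ∈ completeEdges S ↔ (∀ v ∈ e, v ∈ S) ∧ ¬ e.IsDiag := by
  simp [completeEdges, Finset.mem_sym2_iff]

theorem mk_mem_completeEdges {S : Finset α} {a b : α} :
    s(a, b) ∈ completeEdges S ↔ a ∈ S ∧ b ∈ S ∧ a ≠ b := by
  simp [mem_completeEdges, and_assoc]

theorem not_isDiag_of_mem_completeEdges {S : Finset α} {e : Sym2 α} (he : e ∈ completeEdges S) :
    ¬ e.IsDiag := (mem_completeEdges.1 he).2

theorem card_completeEdges (S : Finset α) : (completeEdges S).card = S.card.choose 2 := by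
  rw [← Sym2.card_image_offDiag]
  congr 1
  ext e
  induction e with | _ a b
  simp only [mk_mem_completeEdges, Finset.mem_image, Finset.mem_offDiag, Prod.exists,
    Function.uncurry_apply_pair, Sym2.eq_iff]
  grind

theorem completeEdges_inter (S T : Finset α) :
    completeEdges S ∩ completeEdges T = completeEdges (S ∩ T) := by
  ext e
  simp only [Finset.mem_inter, mem_completeEdges]
  grind

theorem endpoints_completeEdges_subset (S : Finset α) : endpoints (completeEdges S) ⊆ S := by
  intro v hv
  obtain ⟨e, he, hve⟩ := mem_endpoints.1 hv
  exact (mem_completeEdges.1 he).1 v hve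

theorem endpoints_completeEdges {S : Finset α} (hS : 2 ≤ S.card) :
    endpoints (completeEdges S) = S := by
  refine (endpoints_completeEdges_subset S).antisymm fun v hv => ?_
  obtain ⟨w, hw, hwv⟩ := Finset.exists_mem_ne (show 1 < S.card from hS) v
  exact mem_endpoints.2 ⟨s(v, w), mk_mem_completeEdges.2 ⟨hv, hw, hwv.symm⟩, by simp⟩

theorem subset_completeEdges_endpoints {A : Finset (Sym2 α)} (hA : ∀ e ∈ A, ¬ e.IsDiag) :
    A ⊆ completeEdges (endpoints A) := fun e he =>
  mem_completeEdges.2 ⟨fun _ hv => mem_endpoints.2 ⟨e, he, hv⟩, hA e he⟩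

theorem card_le_card_endpoints_choose_two {A : Finset (Sym2 α)} (hA : ∀ e ∈ A, ¬ e.IsDiag) :
    A.card ≤ (endpoints A).card.choose 2 := by
  rw [← card_completeEdges]
  exact Finset.card_le_card (subset_completeEdges_endpoints hA)

/-- The exponent `v - y e` of a graph with `v` vertices and `e` edges, encoded by its edge set: the
expected number of its copies in `G(n, n ^ (-y))` is of order `n ^ (v - y e)`. A single edge has
exponent `2 - y`. -/
def copyExponent (y : ℝ) (A : Finset (Sym2 α)) : ℝ := (endpoints A).card - y * A.card

theorem copyExponent_eq_add_mul_card (x y : ℝ) (A : Finset (Sym2 α)) :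
    copyExponent y A = copyExponent x A + (x - y) * A.card := by
  simp only [copyExponent]
  ring

theorem copyExponent_image {f : β → α} (hf : Function.Injective f) (y : ℝ)
    (A : Finset (Sym2 β)) : copyExponent y (A.image (Sym2.map f)) = copyExponent y A := by
  simp only [copyExponent, endpoints_image, Finset.card_image_of_injective _ hf,
    Finset.card_image_of_injective _ (Sym2.map.injective hf)]

theorem copyExponent_union_add_inter_le (y : ℝ) (A B : Finset (Sym2 α)) :
    copyExponent y (A ∪ B) + copyExponent y (A ∩ B) ≤ copyExponent y A + copyExponent y B := by
  have hinter : endpoints (A ∩ B) ⊆ endpoints A ∩ endpoints B :=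
    Finset.subset_inter (endpoints_mono Finset.inter_subset_left)
      (endpoints_mono Finset.inter_subset_right)
  have hverts : ((endpoints (A ∪ B)).card : ℝ) + (endpoints (A ∩ B)).card ≤
      (endpoints A).card + (endpoints B).card := by
    rw [endpoints_union]
    exact_mod_cast (Nat.add_le_add_left (Finset.card_le_card hinter) _).trans_eq
      (Finset.card_union_add_card_inter _ _)
  have hedges : ((A ∪ B).card : ℝ) + (A ∩ B).card = A.card + B.card := by
    exact_mod_cast Finset.card_union_add_card_inter A B
  simp only [copyExponent]
  linear_combination hverts - y * hedges

theorem copyExponent_completeEdges {S : Finset α} (hS : 2 ≤ S.card) :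
    copyExponent (2 / (S.card + 1)) (completeEdges S) = 2 - 2 / (S.card + 1) := by
  rw [copyExponent, endpoints_completeEdges hS, card_completeEdges, Nat.cast_choose_two]
  field_simp
  ring

theorem two_sub_le_copyExponent_of_subset_completeEdges {S : Finset α} {A : Finset (Sym2 α)}
    (hA : A ⊆ completeEdges S) (hne : A.Nonempty) :
    2 - 2 / (S.card + 1) ≤ copyExponent (2 / (S.card + 1)) A := by
  have hd : ∀ e ∈ A, ¬ e.IsDiag := fun e he => not_isDiag_of_mem_completeEdges (hA he)
  have hv2 : (2 : ℝ) ≤ (endpoints A).card := by exact_mod_cast two_le_card_endpoints hne hd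
  have hvS : ((endpoints A).card : ℝ) ≤ S.card := by
    exact_mod_cast Finset.card_le_card
      ((endpoints_mono hA).trans (endpoints_completeEdges_subset S))
  have he : (A.card : ℝ) ≤ (endpoints A).card * ((endpoints A).card - 1) / 2 := by
    rw [← Nat.cast_choose_two]
    exact_mod_cast card_le_card_endpoints_choose_two hd
  have hmul : 2 * ((A.card : ℝ) - 1) ≤ ((endpoints A).card - 2) * (S.card + 1) := by
    nlinarith
  have hdiv : 2 / ((S.card : ℝ) + 1) * (A.card - 1) ≤ (endpoints A).card - 2 := by
    rwa [div_mul_eq_mul_div, div_le_iff₀ (by positivity)]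
  rw [copyExponent]
  linarith

theorem copyExponent_union_completeEdges_le {U : Finset (Sym2 α)} {K : Finset α}
    (hU : copyExponent (2 / (K.card + 1)) U ≤ 2 - 2 / (K.card + 1))
    (hUK : (U ∩ completeEdges K).Nonempty) :
    copyExponent (2 / (K.card + 1)) (U ∪ completeEdges K) ≤ 2 - 2 / (K.card + 1) := by
  have hK : 2 ≤ K.card :=
    (two_le_card_endpoints (hUK.mono Finset.inter_subset_right)
      fun _ => not_isDiag_of_mem_completeEdges).trans
      (Finset.card_le_card (endpoints_completeEdges_subset K))
  have hinter := two_sub_le_copyExponent_of_subset_completeEdges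
    (Finset.inter_subset_right (s₁ := U) (s₂ := completeEdges K)) hUK
  linarith [copyExponent_union_add_inter_le (2 / ((K.card : ℝ) + 1)) U (completeEdges K),
    copyExponent_completeEdges hK]

end EdgeSets

section Cover

variable {α : Type*} [DecidableEq α] {m : ℕ}

/- A maximal subfamily containing `K` whose union has at most the exponent of a single edge: by the
gluing step, a clique sharing an edge with that union would extend it. -/
theorem exists_cluster (hm : 2 ≤ m) {𝒦 : Finset (Finset α)} (h𝒦 : ∀ K ∈ 𝒦, K.card = m)
    {K : Finset α} (hK : K ∈ 𝒦) :
    ∃ 𝒞 ⊆ 𝒦, K ∈ 𝒞 ∧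
      copyExponent (2 / ((m : ℝ) + 1)) (𝒞.biUnion completeEdges) ≤ 2 - 2 / ((m : ℝ) + 1) ∧
      ∀ L ∈ 𝒦 \ 𝒞, Disjoint (completeEdges L) (𝒞.biUnion completeEdges) := by
  let IsCluster (𝒞 : Finset (Finset α)) : Prop := 𝒞 ⊆ 𝒦 ∧
    copyExponent (2 / ((m : ℝ) + 1)) (𝒞.biUnion completeEdges) ≤ 2 - 2 / ((m : ℝ) + 1)
  have hfin : {𝒞 | IsCluster 𝒞}.Finite :=
    𝒦.powerset.finite_toSet.subset fun 𝒞 h𝒞 => Finset.mem_coe.2 (Finset.mem_powerset.2 h𝒞.1)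
  have hsingleton : IsCluster {K} := by
    refine ⟨Finset.singleton_subset_iff.2 hK, ?_⟩
    rw [Finset.singleton_biUnion, ← h𝒦 K hK]
    exact (copyExponent_completeEdges (h𝒦 K hK ▸ hm)).le
  obtain ⟨𝒞, hK𝒞, h𝒞, hmax⟩ := hfin.exists_le_maximal hsingleton
  refine ⟨𝒞, h𝒞.1, Finset.singleton_subset_iff.1 hK𝒞, h𝒞.2, fun L hL => ?_⟩
  obtain ⟨hL𝒦, hL𝒞⟩ := Finset.mem_sdiff.1 hL
  by_contra hmeet
  refine hL𝒞 (hmax (y := insert L 𝒞) ⟨Finset.insert_subset hL𝒦 h𝒞.1, ?_⟩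
    (Finset.subset_insert L 𝒞) (Finset.mem_insert_self L 𝒞))
  rw [Finset.biUnion_insert, Finset.union_comm, ← h𝒦 L hL𝒦]
  refine copyExponent_union_completeEdges_le (by rw [h𝒦 L hL𝒦]; exact h𝒞.2) ?_
  rwa [Finset.inter_comm, ← Finset.not_disjoint_iff_nonempty_inter]

theorem copyExponent_le_of_copyExponent_le {y₀ y κ : ℝ} {U : Finset (Sym2 α)}
    (hU : copyExponent y₀ U ≤ 2 - y₀) (hne : U.Nonempty) (hκ : 0 ≤ 1 + κ)
    (hy : (1 + κ) * y₀ ≤ y) :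
    copyExponent y U ≤ 2 - y - κ * ((endpoints U).card - 2) := by
  have hedge : (0 : ℝ) ≤ U.card - 1 := by
    rw [sub_nonneg]
    exact_mod_cast hne.card_pos
  have hverts : ((endpoints U).card : ℝ) - 2 ≤ y₀ * (U.card - 1) := by
    rw [copyExponent] at hU
    linarith
  have hgain : (1 + κ) * ((endpoints U).card - 2) ≤ y * (U.card - 1) :=
    calc (1 + κ) * (((endpoints U).card : ℝ) - 2) ≤ (1 + κ) * (y₀ * (U.card - 1)) := by gcongr
      _ = (1 + κ) * y₀ * (U.card - 1) := by ring
      _ ≤ y * (U.card - 1) := by gcongr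
  rw [copyExponent]
  linarith

/- `U` beats a single edge by `2 γ (v(U) - 2)`, while `X ∩ U` is at most `γ` below a single edge;
half of the gain pays for that and the other half for the edges of `X ∩ U`. -/
theorem copyExponent_union_le_sub {y₀ x y γ ε : ℝ} {X U : Finset (Sym2 α)} (hx : 0 < x)
    (hyx : y ≤ x) (hxy : x - y ≤ γ) (hy : (1 + 2 * γ) * y₀ ≤ y) (hε : 0 ≤ ε)
    (hεγ : ε * (1 / x + 1) ≤ γ) (hU : copyExponent y₀ U ≤ 2 - y₀) (hU3 : 3 ≤ (endpoints U).card)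
    (hne : (X ∩ U).Nonempty) (hXU : 2 - x ≤ copyExponent x (X ∩ U)) :
    copyExponent y (X ∪ U) ≤ copyExponent y X - ε * (X ∩ U).card := by
  have hγ : 0 ≤ γ := (sub_nonneg.2 hyx).trans hxy
  have hu : (1 : ℝ) ≤ (endpoints U).card - 2 := by
    have : (3 : ℝ) ≤ (endpoints U).card := by exact_mod_cast hU3
    linarith
  have hgain := copyExponent_le_of_copyExponent_le hU (hne.mono Finset.inter_subset_right)
    (by positivity) hy
  have hloss : 2 - x ≤ copyExponent y (X ∩ U) := by
    rw [copyExponent_eq_add_mul_card x y]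
    linarith [mul_nonneg (sub_nonneg.2 hyx) (Nat.cast_nonneg (α := ℝ) (X ∩ U).card)]
  have hedges : ε * (X ∩ U).card ≤ γ * ((endpoints U).card - 2) := by
    have hverts : ((endpoints (X ∩ U)).card : ℝ) ≤ (endpoints U).card := by
      exact_mod_cast Finset.card_le_card (endpoints_mono Finset.inter_subset_right)
    have hcard : ((X ∩ U).card : ℝ) ≤ (1 / x + 1) * ((endpoints U).card - 2) := by
      rw [copyExponent] at hXU
      have : ((X ∩ U).card : ℝ) - 1 ≤ 1 / x * ((endpoints U).card - 2) := by
        rw [one_div_mul_eq_div, le_div_iff₀ hx]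
        linarith
      linarith
    calc ε * ((X ∩ U).card : ℝ) ≤ ε * ((1 / x + 1) * ((endpoints U).card - 2)) := by gcongr
      _ = ε * (1 / x + 1) * ((endpoints U).card - 2) := by ring
      _ ≤ γ * ((endpoints U).card - 2) := by gcongr
  linarith [copyExponent_union_add_inter_le y X U, le_mul_of_one_le_right hγ hu]

theorem copyExponent_union_cliques_le (hm : 3 ≤ m) {x y γ ε : ℝ} (hx : 0 < x)
    (hyx : y ≤ x) (hxy : x - y ≤ γ) (hy : (1 + 2 * γ) * (2 / ((m : ℝ) + 1)) ≤ y) (hε : 0 ≤ ε)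
    (hεγ : ε * (1 / x + 1) ≤ γ) {E : Finset (Sym2 α)}
    (hE : ∀ A ⊆ E, A.Nonempty → 2 - x ≤ copyExponent x A)
    (𝒦 : Finset (Finset α)) (h𝒦 : ∀ K ∈ 𝒦, K.card = m)
    (h𝒦E : ∀ K ∈ 𝒦, (E ∩ completeEdges K).Nonempty) :
    copyExponent y (E ∪ 𝒦.biUnion completeEdges) ≤
      copyExponent y E - ε * (E ∩ 𝒦.biUnion completeEdges).card := by
  induction 𝒦 using Finset.strongInduction with
  | H 𝒦 ih =>
  obtain rfl | ⟨K, hK⟩ := 𝒦.eq_empty_or_nonempty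
  · simp
  obtain ⟨𝒞, h𝒞𝒦, hK𝒞, hdense, hdisj⟩ := exists_cluster (by omega) h𝒦 hK
  have hrest : ∀ L ∈ 𝒦 \ 𝒞, L ∈ 𝒦 := fun L hL => (Finset.mem_sdiff.1 hL).1
  have IH := ih (𝒦 \ 𝒞) (Finset.sdiff_ssubset h𝒞𝒦 ⟨K, hK𝒞⟩) (fun L hL => h𝒦 L (hrest L hL))
    (fun L hL => h𝒦E L (hrest L hL))
  rw [← Finset.disjoint_biUnion_left] at hdisj
  set U := 𝒞.biUnion completeEdges
  set Y := (𝒦 \ 𝒞).biUnion completeEdges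
  have hKU : completeEdges K ⊆ U := Finset.subset_biUnion_of_mem completeEdges hK𝒞
  have hsplit : 𝒦.biUnion completeEdges = Y ∪ U := by
    rw [← Finset.union_biUnion, Finset.sdiff_union_of_subset h𝒞𝒦]
  have hmeet : (E ∪ Y) ∩ U = E ∩ U := by
    rw [Finset.union_inter_distrib_right, Finset.disjoint_iff_inter_eq_empty.1 hdisj,
      Finset.union_empty]
  have hne : (E ∩ U).Nonempty := (h𝒦E K hK).mono (Finset.inter_subset_inter_left hKU)
  have hU3 : 3 ≤ (endpoints U).card := by
    have hKm := h𝒦 K hK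
    calc 3 ≤ (endpoints (completeEdges K)).card := by
          rwa [endpoints_completeEdges (by omega), hKm]
      _ ≤ (endpoints U).card := Finset.card_le_card (endpoints_mono hKU)
  have hcovered : ((E ∩ (Y ∪ U)).card : ℝ) = (E ∩ Y).card + (E ∩ U).card := by
    rw [Finset.inter_union_distrib_left, Finset.card_union_of_disjoint
      (hdisj.mono Finset.inter_subset_right Finset.inter_subset_right), Nat.cast_add]
  have hstep := copyExponent_union_le_sub (X := E ∪ Y) hx hyx hxy hy hε hεγ hdense hU3
    (by rwa [hmeet]) (by rw [hmeet]; exact hE _ Finset.inter_subset_left hne)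
  rw [hmeet, Finset.union_assoc] at hstep
  rw [hsplit, hcovered]
  linarith

end Cover

section Density

theorem twoDensity_completeGraph_le {m : ℕ} (hm : 3 ≤ m) :
    twoDensity (⊤ : SimpleGraph (Fin m)) ≤ ((m : ℝ) + 1) / 2 := by
  classical
  obtain ⟨H, hH, hx⟩ := (isGreatest_twoDensity (⊤ : SimpleGraph (Fin m)) (by simpa using hm)).1
  have hedges : H.edgeSet.ncard ≤ H.verts.ncard.choose 2 := by
    rw [Set.ncard_eq_toFinset_card' H.verts, ← card_completeEdges, ← Set.ncard_coe_finset]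
    refine Set.ncard_le_ncard fun e he => mem_completeEdges.2 ⟨fun v hv => ?_, ?_⟩
    · exact Set.mem_toFinset.2 (H.mem_verts_of_mem_edge he hv)
    · exact SimpleGraph.not_isDiag_of_mem_edgeSet _ (H.edgeSet_subset he)
  have he : (H.edgeSet.ncard : ℝ) ≤ H.verts.ncard * (H.verts.ncard - 1) / 2 := by
    rw [← Nat.cast_choose_two]
    exact_mod_cast hedges
  have hv : (3 : ℝ) ≤ H.verts.ncard := by exact_mod_cast hH
  have hvm : (H.verts.ncard : ℝ) ≤ m := by
    exact_mod_cast (Set.ncard_le_card H.verts).trans_eq (Nat.card_fin m)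
  rw [hx, div_le_iff₀ (by linarith)]
  nlinarith

theorem exists_subgraph_edgeSet_eq {V : Type*} [DecidableEq V] {H : SimpleGraph V}
    {A : Finset (Sym2 V)} (hA : ↑A ⊆ H.edgeSet) :
    ∃ H' : H.Subgraph, H'.verts = endpoints A ∧ H'.edgeSet = A :=
  ⟨{ verts := endpoints A
     Adj := fun a b => s(a, b) ∈ A
     adj_sub := fun h => hA h
     edge_vert := fun h => mem_endpoints.2 ⟨_, h, Sym2.mem_mk_left _ _⟩
     symm := ⟨fun a b h => by rwa [Sym2.eq_swap]⟩ },
    rfl, Set.ext fun e => e.ind fun _ _ => Iff.rfl⟩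

variable {V : Type*} {H : SimpleGraph V}

theorem card_le_twoDensity_mul_add_one [Finite V] [DecidableEq V] {A : Finset (Sym2 V)}
    (hA : ↑A ⊆ H.edgeSet) (hne : A.Nonempty) :
    (A.card : ℝ) ≤ twoDensity H * ((endpoints A).card - 2) + 1 := by
  have := Fintype.ofFinite V
  have hd : ∀ e ∈ A, ¬ e.IsDiag := fun e he => SimpleGraph.not_isDiag_of_mem_edgeSet _ (hA he)
  obtain htwo | hthree := (two_le_card_endpoints hne hd).eq_or_lt
  · have hone : A.card ≤ 1 := by
      simpa [← htwo] using card_le_card_endpoints_choose_two hd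
    rw [← htwo]
    simpa using hone
  · obtain ⟨H', hverts, hedges⟩ := exists_subgraph_edgeSet_eq hA
    have hmax : ((A.card : ℝ) - 1) / ((endpoints A).card - 2) ≤ twoDensity H :=
      (isGreatest_twoDensity H (hthree.trans_le (Finset.card_le_univ _))).2 ⟨H', by
        rwa [hverts, Set.ncard_coe_finset], by
        rw [hverts, hedges, Set.ncard_coe_finset, Set.ncard_coe_finset]⟩
    have hpos : (0 : ℝ) < (endpoints A).card - 2 := by
      rw [sub_pos]
      exact_mod_cast hthree
    rw [div_le_iff₀ hpos] at hmax
    linarith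

theorem two_sub_le_copyExponent_of_subset_edgeSet [Finite V] [DecidableEq V]
    (hH : 0 < twoDensity H) {A : Finset (Sym2 V)} (hA : ↑A ⊆ H.edgeSet) (hne : A.Nonempty) :
    2 - 1 / twoDensity H ≤ copyExponent (1 / twoDensity H) A := by
  have hdiv : 1 / twoDensity H * (A.card - 1) ≤ (endpoints A).card - 2 := by
    rw [one_div_mul_eq_div, div_le_iff₀' hH]
    linarith [card_le_twoDensity_mul_add_one hA hne]
  rw [copyExponent]
  linarith

theorem half_le_twoDensity [Finite V] (hH : H.edgeSet.Nontrivial) : 1 / 2 ≤ twoDensity H := by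
  classical
  obtain ⟨e, he, f, hf, hef⟩ := hH
  have hsub : (↑({e, f} : Finset (Sym2 V)) : Set (Sym2 V)) ⊆ H.edgeSet := by
    simp [Set.insert_subset_iff, he, hf]
  have hlower : (2 : ℝ) ≤ (endpoints {e, f}).card := by
    exact_mod_cast two_le_card_endpoints (Finset.insert_nonempty e {f}) fun _ h =>
      SimpleGraph.not_isDiag_of_mem_edgeSet _ (hsub h)
  have hupper : ((endpoints {e, f}).card : ℝ) ≤ 2 * 2 := by
    exact_mod_cast Finset.card_pair hef ▸ card_endpoints_le {e, f}
  have hdensity := card_le_twoDensity_mul_add_one hsub (Finset.insert_nonempty e {f})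
  rw [Finset.card_pair hef] at hdensity
  push_cast at hdensity
  have hpos : 0 < twoDensity H := by nlinarith
  nlinarith

theorem edgeSet_nontrivial_of_two_lt_chromaticNumber (hH : 2 < H.chromaticNumber) :
    H.edgeSet.Nontrivial := by
  classical
  contrapose! hH
  suffices H.Colorable 2 from this.chromaticNumber_le
  obtain hempty | ⟨e, he⟩ := hH.eq_empty_or_singleton
  · rw [SimpleGraph.edgeSet_eq_empty] at hempty
    exact ⟨SimpleGraph.Coloring.mk 0 (by simp [hempty])⟩
  · induction e with | _ a b
    refine ⟨SimpleGraph.Coloring.mk (fun v => if v = a then 0 else 1) fun {v w} hvw => ?_⟩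
    have hedge : s(v, w) = s(a, b) := by
      rw [← Set.mem_singleton_iff, ← he]
      exact hvw
    have := hvw.ne
    grind [Sym2.eq_iff]

theorem card_edgeSet_eq_of_twoDensity_eq {H₀ : H.Subgraph} (hv : 3 ≤ H₀.verts.ncard)
    (hH₀ : ((H₀.edgeSet.ncard : ℝ) - 1) / ((H₀.verts.ncard : ℝ) - 2) = twoDensity H) :
    (H₀.edgeSet.ncard : ℝ) = twoDensity H * ((H₀.verts.ncard : ℝ) - 2) + 1 := by
  have hv' : (3 : ℝ) ≤ H₀.verts.ncard := by exact_mod_cast hv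
  rw [div_eq_iff (by linarith)] at hH₀
  linarith

theorem card_verts_le_of_twoDensity_eq {H₀ : H.Subgraph} (hH : 1 / 2 ≤ twoDensity H)
    (hv : 3 ≤ H₀.verts.ncard)
    (hH₀ : ((H₀.edgeSet.ncard : ℝ) - 1) / ((H₀.verts.ncard : ℝ) - 2) = twoDensity H) :
    (H₀.verts.ncard : ℝ) ≤ 2 * H₀.edgeSet.ncard := by
  have hv' : (3 : ℝ) ≤ H₀.verts.ncard := by exact_mod_cast hv
  rw [card_edgeSet_eq_of_twoDensity_eq hv hH₀]
  nlinarith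

theorem copyExponent_edgeSet_le_of_twoDensity_eq [DecidableEq V] {H₀ : H.Subgraph}
    {E : Finset (Sym2 V)} (hE : H₀.edgeSet = E) (hH : 0 < twoDensity H) (hv : 3 ≤ H₀.verts.ncard)
    (hH₀ : ((H₀.edgeSet.ncard : ℝ) - 1) / ((H₀.verts.ncard : ℝ) - 2) = twoDensity H) :
    copyExponent (1 / twoDensity H) E ≤ 2 - 1 / twoDensity H := by
  have hverts : ((endpoints E).card : ℝ) ≤ H₀.verts.ncard := by
    have hsub : ↑(endpoints E) ⊆ H₀.verts := fun v hv => by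
      obtain ⟨e, he, hve⟩ := mem_endpoints.1 hv
      exact H₀.mem_verts_of_mem_edge (hE ▸ he) hve
    rw [← Set.ncard_coe_finset]
    exact_mod_cast Set.ncard_le_ncard hsub (Set.finite_of_ncard_pos (by omega))
  have hedges := card_edgeSet_eq_of_twoDensity_eq hv hH₀
  rw [hE, Set.ncard_coe_finset] at hedges
  have : 1 / twoDensity H * E.card = H₀.verts.ncard - 2 + 1 / twoDensity H := by
    rw [hedges]
    field_simp
  rw [copyExponent]
  linarith

end Density

section CliqueGraph

variable {α : Type*} {m : ℕ} {G : SimpleGraph α}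

/-- The subgraph of `G` formed by the edges lying in cliques of size `m`. -/
def cliqueGraph (m : ℕ) (G : SimpleGraph α) : SimpleGraph α where
  Adj a b := a ≠ b ∧ ∃ K, G.IsNClique m K ∧ a ∈ K ∧ b ∈ K
  symm := ⟨fun _ _ ⟨h, K, hK, ha, hb⟩ => ⟨h.symm, K, hK, hb, ha⟩⟩
  loopless := ⟨fun _ h => h.1 rfl⟩

theorem cliqueGraph_le (m : ℕ) (G : SimpleGraph α) : cliqueGraph m G ≤ G :=
  fun _ _ ⟨h, _, hK, ha, hb⟩ => hK.isClique ha hb h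

theorem isNClique_cliqueGraph_iff {K : Finset α} :
    (cliqueGraph m G).IsNClique m K ↔ G.IsNClique m K :=
  ⟨fun h => h.mono (cliqueGraph_le m G), fun h =>
    ⟨fun _ ha _ hb hab => ⟨hab, K, h, ha, hb⟩, h.card_eq⟩⟩

variable [DecidableEq α]

theorem coe_completeEdges_subset_iff {K : Finset α} :
    ↑(completeEdges K) ⊆ G.edgeSet ↔ G.IsClique K := by
  constructor
  · intro h a ha b hb hab
    exact h (mk_mem_completeEdges.2 ⟨ha, hb, hab⟩)
  · intro h e he
    induction e with | _ a b
    obtain ⟨ha, hb, hab⟩ := mk_mem_completeEdges.1 he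
    exact h ha hb hab

theorem exists_clique_cover {E : Finset (Sym2 α)} (hE : ↑E ⊆ (cliqueGraph m G).edgeSet) :
    ∃ 𝒦 : Finset (Finset α), 𝒦.card ≤ E.card ∧ (∀ K ∈ 𝒦, G.IsNClique m K) ∧
      (∀ K ∈ 𝒦, (E ∩ completeEdges K).Nonempty) ∧ E ⊆ 𝒦.biUnion completeEdges := by
  have hclique : ∀ e ∈ E, ∃ K, G.IsNClique m K ∧ e ∈ completeEdges K := by
    intro e he
    have hadj := hE he
    induction e with | _ a b
    obtain ⟨hab, K, hK, ha, hb⟩ := hadj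
    exact ⟨K, hK, mk_mem_completeEdges.2 ⟨ha, hb, hab⟩⟩
  choose! K hK heK using hclique
  refine ⟨E.image K, Finset.card_image_le, Finset.forall_mem_image.2 hK,
    Finset.forall_mem_image.2 fun e he => ⟨e, Finset.mem_inter.2 ⟨he, heK e he⟩⟩, fun e he =>
    Finset.mem_biUnion.2 ⟨K e, Finset.mem_image_of_mem K he, heK e he⟩⟩

theorem card_endpoints_biUnion_completeEdges_le {𝒦 : Finset (Finset α)}
    (h𝒦 : ∀ K ∈ 𝒦, K.card = m) :
    (endpoints (𝒦.biUnion completeEdges)).card ≤ 𝒦.card * m := by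
  have hsub : endpoints (𝒦.biUnion completeEdges) ⊆ 𝒦.biUnion id := by
    rw [endpoints, Finset.biUnion_biUnion]
    exact Finset.biUnion_mono fun K _ => endpoints_completeEdges_subset K
  exact (Finset.card_le_card hsub).trans
    (Finset.card_biUnion_le_card_mul _ _ _ fun K hK => (h𝒦 K hK).le)

theorem exists_copyExponent_le_sub (hm : 3 ≤ m) {x y γ ε : ℝ} (hx : 0 < x)
    (hyx : y ≤ x) (hxy : x - y ≤ γ) (hy : (1 + 2 * γ) * (2 / ((m : ℝ) + 1)) ≤ y) (hε : 0 ≤ ε)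
    (hεγ : ε * (1 / x + 1) ≤ γ) {E : Finset (Sym2 α)} (hE : ↑E ⊆ (cliqueGraph m G).edgeSet)
    (hsparse : ∀ A ⊆ E, A.Nonempty → 2 - x ≤ copyExponent x A) :
    ∃ F : Finset (Sym2 α), ↑F ⊆ G.edgeSet ∧ (endpoints F).card ≤ E.card * m ∧
      copyExponent y F ≤ copyExponent y E - ε * E.card := by
  obtain ⟨𝒦, hcard, h𝒦, hmeet, hcover⟩ := exists_clique_cover hE
  have hle := copyExponent_union_cliques_le hm hx hyx hxy hy hε hεγ hsparse 𝒦
    (fun K hK => (h𝒦 K hK).card_eq) hmeet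
  rw [Finset.union_eq_right.2 hcover, Finset.inter_eq_left.2 hcover] at hle
  refine ⟨𝒦.biUnion completeEdges, ?_, ?_, hle⟩
  · rw [Finset.coe_biUnion]
    exact Set.iUnion₂_subset fun K hK => coe_completeEdges_subset_iff.2 (h𝒦 K hK).isClique
  · exact (card_endpoints_biUnion_completeEdges_le fun K hK => (h𝒦 K hK).card_eq).trans
      (Nat.mul_le_mul_right m hcard)

theorem exists_copyExponent_le_of_copy {V : Type*} [Finite V] [DecidableEq V]
    {H : SimpleGraph V} (hm : 3 ≤ m) {γ δ ε : ℝ} (hH : 0 < twoDensity H) (hδ : 0 ≤ δ) (hδγ : δ ≤ γ)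
    (hy : (1 + 2 * γ) * (2 / ((m : ℝ) + 1)) ≤ 1 / twoDensity H - δ) (hε : 0 ≤ ε)
    (hεγ : ε * (twoDensity H + 1) ≤ γ) (f : H.Copy (cliqueGraph m G)) {E : Finset (Sym2 V)}
    (hE : ↑E ⊆ H.edgeSet) :
    ∃ F : Finset (Sym2 α), ↑F ⊆ G.edgeSet ∧ (endpoints F).card ≤ E.card * m ∧
      copyExponent (1 / twoDensity H - δ) F ≤
        copyExponent (1 / twoDensity H - δ) E - ε * E.card := by
  have hinj : Function.Injective f := f.injective
  have himage : ↑(E.image (Sym2.map f)) ⊆ (cliqueGraph m G).edgeSet := by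
    rw [Finset.coe_image]
    rintro _ ⟨e, he, rfl⟩
    exact f.toHom.map_mem_edgeSet (hE he)
  have hsparse : ∀ A ⊆ E.image (Sym2.map f), A.Nonempty →
      2 - 1 / twoDensity H ≤ copyExponent (1 / twoDensity H) A := by
    intro A hA hne
    obtain ⟨B, hB, rfl⟩ := Finset.subset_image_iff.1 hA
    rw [copyExponent_image hinj]
    exact two_sub_le_copyExponent_of_subset_edgeSet hH ((Finset.coe_subset.2 hB).trans hE)
      (Finset.image_nonempty.1 hne)
  rw [← copyExponent_image hinj, ← Finset.card_image_of_injective E (Sym2.map.injective hinj)]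
  exact exists_copyExponent_le_sub hm (one_div_pos.2 hH) (by linarith) (by linarith) hy hε
    (by rwa [one_div_one_div]) himage hsparse

end CliqueGraph

section DenseWitness

variable {m : ℕ}

/- `γ` is a quarter of the relative gap between `1 / c` and the critical exponent `2 / (m + 1)`. -/
theorem exists_exponent_parameters (hm : 3 ≤ m) {c : ℝ} (hc : c < ((m : ℝ) + 1) / 2) :
    ∃ γ ε δ : ℝ, 0 < ε ∧ 0 < δ ∧ δ ≤ ε / 2 ∧ δ ≤ γ ∧ ∀ μ : ℝ, 0 < μ → μ < c →
      ε * (μ + 1) ≤ γ ∧ (1 + 2 * γ) * (2 / ((m : ℝ) + 1)) ≤ 1 / μ - δ := by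
  have hm' : (3 : ℝ) ≤ m := by exact_mod_cast hm
  obtain ⟨d, hcd, hd1, hdm⟩ : ∃ d : ℝ, c ≤ d ∧ 1 ≤ d ∧ d < (m + 1) / 2 :=
    ⟨max c 1, le_max_left _ _, le_max_right _ _, max_lt hc (by linarith)⟩
  have hgap : 1 < ((m : ℝ) + 1) / 2 / d := by rwa [one_lt_div (by linarith)]
  set γ : ℝ := (((m : ℝ) + 1) / 2 / d - 1) / 4 with hγ
  have hγpos : 0 < γ := by linarith
  set ε : ℝ := γ / (d + 1)
  have hεpos : 0 < ε := by positivity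
  have hεγ : ε * (d + 1) = γ := div_mul_cancel₀ _ (by linarith)
  have hε_le : ε ≤ γ := by nlinarith
  have hδε : ε / (m + 1) ≤ ε / 2 := by gcongr; linarith
  refine ⟨γ, ε, ε / (m + 1), hεpos, by positivity, hδε, by linarith, fun μ hμ hμc => ⟨?_, ?_⟩⟩
  · rw [← hεγ]
    gcongr
    linarith
  · have hinv : 1 / d ≤ 1 / μ := one_div_le_one_div_of_le hμ (by linarith)
    calc (1 + 2 * γ) * (2 / ((m : ℝ) + 1)) ≤ (1 + 4 * γ - ε / 2) * (2 / (m + 1)) := by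
          gcongr
          linarith
      _ = 1 / d - ε / (m + 1) := by
          rw [hγ]
          field_simp
          ring
      _ ≤ 1 / μ - ε / (m + 1) := by linarith

theorem exists_copyExponent_le_neg_one (hm : 3 ≤ m) {c : ℝ} (hc : c < ((m : ℝ) + 1) / 2) :
    ∃ (M : ℕ) (δ : ℝ), 0 < δ ∧ ∀ (V : Type*) [Fintype V] (H : SimpleGraph V),
      H.edgeSet.Nontrivial → twoDensity H < c →
      (∃ H₀ : H.Subgraph,
        ((H₀.edgeSet.ncard : ℝ) - 1) / ((H₀.verts.ncard : ℝ) - 2) = twoDensity H ∧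
        M < H₀.verts.ncard) →
      ∀ (α : Type*) [DecidableEq α] (G : SimpleGraph α), ¬ H.Free (cliqueGraph m G) →
        ∃ F : Finset (Sym2 α), ↑F ⊆ G.edgeSet ∧ (endpoints F).card ≤ Fintype.card (Sym2 V) * m ∧
          copyExponent (1 / twoDensity H - δ) F ≤ -1 := by
  classical
  obtain ⟨γ, ε, δ, hε, hδ, hδε, hδγ, hparam⟩ := exists_exponent_parameters hm hc
  refine ⟨max 2 ⌈12 / ε⌉₊, δ, hδ, fun V _ H hH hHc ⟨H₀, hH₀, hM⟩ α _ G hcopy => ?_⟩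
  have hhalf := half_le_twoDensity hH
  have hpos : 0 < twoDensity H := by linarith
  obtain ⟨hεμ, hy⟩ := hparam _ hpos hHc
  obtain ⟨hM2, hMε⟩ := max_lt_iff.1 hM
  obtain ⟨f⟩ := not_not.1 hcopy
  set E := H₀.edgeSet.toFinset
  have hE : H₀.edgeSet = E := (Set.coe_toFinset _).symm
  obtain ⟨F, hFG, hFcard, hF⟩ := exists_copyExponent_le_of_copy hm hpos hδ.le hδγ hy hε.le hεμ f
    (hE ▸ H₀.edgeSet_subset)
  refine ⟨F, hFG, hFcard.trans (Nat.mul_le_mul_right m (Finset.card_le_univ _)), hF.trans ?_⟩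
  have hedges : 12 / ε ≤ 2 * E.card := by
    have hverts := card_verts_le_of_twoDensity_eq hhalf hM2 hH₀
    rw [hE, Set.ncard_coe_finset] at hverts
    exact (Nat.ceil_le.1 hMε.le).trans hverts
  rw [div_le_iff₀ hε] at hedges
  have hexp := copyExponent_edgeSet_le_of_twoDensity_eq hE hpos hM2 hH₀
  have hloss : δ * E.card ≤ ε / 2 * E.card := mul_le_mul_of_nonneg_right hδε (Nat.cast_nonneg _)
  rw [copyExponent_eq_add_mul_card (1 / twoDensity H)]
  linarith [one_div_pos.2 hpos]

end DenseWitness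

section FirstMoment

open unitInterval SimpleGraph

instance discreteMeasurableSpace_simpleGraph {V : Type*} [Finite V] :
    DiscreteMeasurableSpace (SimpleGraph V) where
  forall_measurableSet S := by
    rw [← Set.preimage_image_eq S edgeSet_injective]
    exact measurable_edgeSet (Set.toFinite _).measurableSet

/-- The event that all the edges in `A` are present. -/
def containing {V : Type*} (A : Finset (Sym2 V)) : Set (SimpleGraph V) := {G | ↑A ⊆ G.edgeSet}

theorem binomialRandom_real_containing {V : Type*} [Finite V] (p : I) {A : Finset (Sym2 V)}
    (hA : ∀ e ∈ A, ¬ e.IsDiag) :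
    (binomialRandom V p).real (containing A) = (p : ℝ) ^ A.card := by
  have hcylinder : (fun P : Sym2 V → Prop => {e | P e}) ⁻¹' (fromEdgeSet ⁻¹' containing A) =
      Set.pi (A : Set (Sym2 V)) fun _ => {True} := by
    ext P
    simp only [containing, Set.mem_preimage, Set.mem_ofPred_eq, edgeSet_fromEdgeSet, Set.mem_pi,
      Set.mem_singleton_iff, eq_iff_iff, iff_true]
    exact ⟨fun h e he => (h he).1, fun h e he => ⟨h e he, hA e he⟩⟩
  rw [measureReal_def, binomialRandom_eq_map,
    Measure.map_apply measurable_fromEdgeSet MeasurableSet.of_discrete,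
    ProbabilityTheory.setBernoulli_apply', hcylinder,
    Measure.infinitePi_pi _ fun _ _ => MeasurableSet.of_discrete,
    Finset.prod_congr rfl (g := fun _ => (toNNReal p : ENNReal))]
  · simp
  · intro e he
    simp [hA e he, Set.indicator]

variable {V : Type*} [DecidableEq V]

theorem pow_card_le_rpow_of_copyExponent_le {N y η q : ℝ} (hN : 1 ≤ N)
    (hq : 0 ≤ q) (hqy : q ≤ N ^ (-y)) {A : Finset (Sym2 V)} (hA : copyExponent y A ≤ -η) :
    q ^ A.card ≤ N ^ (-η - (endpoints A).card) :=
  calc q ^ A.card ≤ (N ^ (-y)) ^ A.card := by gcongr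
    _ = N ^ (copyExponent y A - (endpoints A).card) := by
      rw [← Real.rpow_natCast, ← Real.rpow_mul (by linarith), copyExponent]
      ring_nf
    _ ≤ N ^ (-η - (endpoints A).card) := by gcongr

variable [Fintype V] [Nonempty V] {p : I} {y : ℝ}

theorem binomialRandom_real_exists_endpoints_eq_le (hp : (p : ℝ) ≤ Fintype.card V ^ (-y)) (η : ℝ)
    (S : Finset V) :
    (binomialRandom V p).real {G | ∃ F : Finset (Sym2 V), ↑F ⊆ G.edgeSet ∧ endpoints F = S ∧
      copyExponent y F ≤ -η} ≤ 2 ^ S.card.choose 2 * Fintype.card V ^ (-η - S.card) := by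
  set 𝓕 := (completeEdges S).powerset.filter fun F => endpoints F = S ∧ copyExponent y F ≤ -η
  have hcard : (𝓕.card : ℝ) ≤ 2 ^ S.card.choose 2 := by
    rw [← card_completeEdges]
    exact_mod_cast (Finset.card_filter_le _ _).trans_eq (Finset.card_powerset _)
  calc (binomialRandom V p).real _
      ≤ (binomialRandom V p).real (⋃ F ∈ 𝓕, containing F) := by
        refine measureReal_mono ?_ (measure_ne_top _ _)
        rintro G ⟨F, hFG, rfl, hF⟩
        refine Set.mem_biUnion (Finset.mem_filter.2 ⟨Finset.mem_powerset.2 ?_, rfl, hF⟩) hFG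
        exact subset_completeEdges_endpoints fun e he => not_isDiag_of_mem_edgeSet _ (hFG he)
    _ ≤ ∑ F ∈ 𝓕, (binomialRandom V p).real (containing F) := measureReal_biUnion_finset_le _ _
    _ ≤ 𝓕.card • (Fintype.card V : ℝ) ^ (-η - S.card) := by
        refine Finset.sum_le_card_nsmul _ _ _ fun F hF => ?_
        obtain ⟨hFS, rfl, hexp⟩ := Finset.mem_filter.1 hF
        rw [binomialRandom_real_containing p fun e he =>
          not_isDiag_of_mem_completeEdges (Finset.mem_powerset.1 hFS he)]
        exact pow_card_le_rpow_of_copyExponent_le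
          (Nat.one_le_cast.2 Fintype.card_pos) p.2.1 hp hexp
    _ ≤ 2 ^ S.card.choose 2 * Fintype.card V ^ (-η - S.card) := by
        rw [nsmul_eq_mul]
        gcongr

theorem binomialRandom_real_exists_card_endpoints_eq_le (hp : (p : ℝ) ≤ Fintype.card V ^ (-y))
    (η : ℝ) (s : ℕ) :
    (binomialRandom V p).real {G | ∃ F : Finset (Sym2 V), ↑F ⊆ G.edgeSet ∧
      (endpoints F).card = s ∧ copyExponent y F ≤ -η} ≤
      2 ^ s.choose 2 * Fintype.card V ^ (-η) := by
  have hN : (0 : ℝ) < Fintype.card V := Nat.cast_pos.2 Fintype.card_pos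
  let event (S : Finset V) : Set (SimpleGraph V) :=
    {G | ∃ F : Finset (Sym2 V), ↑F ⊆ G.edgeSet ∧ endpoints F = S ∧ copyExponent y F ≤ -η}
  calc (binomialRandom V p).real _
      ≤ (binomialRandom V p).real (⋃ S ∈ Finset.univ.powersetCard s, event S) := by
        refine measureReal_mono ?_ (measure_ne_top _ _)
        rintro G ⟨F, hFG, hs, hF⟩
        exact Set.mem_biUnion (Finset.mem_powersetCard.2 ⟨Finset.subset_univ _, hs⟩)
          ⟨F, hFG, rfl, hF⟩
    _ ≤ ∑ S ∈ Finset.univ.powersetCard s, (binomialRandom V p).real (event S) :=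
        measureReal_biUnion_finset_le _ _
    _ ≤ (Finset.univ.powersetCard s : Finset (Finset V)).card •
          (2 ^ s.choose 2 * (Fintype.card V : ℝ) ^ (-η - s)) := by
        refine Finset.sum_le_card_nsmul _ _ _ fun S hS => ?_
        rw [← (Finset.mem_powersetCard.1 hS).2]
        exact binomialRandom_real_exists_endpoints_eq_le hp η S
    _ ≤ (Fintype.card V : ℝ) ^ s * (2 ^ s.choose 2 * (Fintype.card V : ℝ) ^ (-η - s)) := by
        rw [nsmul_eq_mul, Finset.card_powersetCard, Finset.card_univ]
        gcongr
        exact_mod_cast Nat.choose_le_pow _ _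
    _ = 2 ^ s.choose 2 * Fintype.card V ^ (-η) := by
        rw [Real.rpow_sub hN, Real.rpow_natCast]
        field_simp

theorem binomialRandom_real_exists_card_endpoints_le (hp : (p : ℝ) ≤ Fintype.card V ^ (-y))
    (η : ℝ) (C : ℕ) :
    (binomialRandom V p).real {G | ∃ F : Finset (Sym2 V), ↑F ⊆ G.edgeSet ∧
      (endpoints F).card ≤ C ∧ copyExponent y F ≤ -η} ≤
      (∑ s ∈ Finset.range (C + 1), 2 ^ s.choose 2) * Fintype.card V ^ (-η) := by
  let event (s : ℕ) : Set (SimpleGraph V) :=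
    {G | ∃ F : Finset (Sym2 V), ↑F ⊆ G.edgeSet ∧ (endpoints F).card = s ∧ copyExponent y F ≤ -η}
  calc (binomialRandom V p).real _
      ≤ (binomialRandom V p).real (⋃ s ∈ Finset.range (C + 1), event s) := by
        refine measureReal_mono ?_ (measure_ne_top _ _)
        rintro G ⟨F, hFG, hC, hF⟩
        exact Set.mem_biUnion (Finset.mem_range_succ_iff.2 hC) ⟨F, hFG, rfl, hF⟩
    _ ≤ ∑ s ∈ Finset.range (C + 1), (binomialRandom V p).real (event s) :=
        measureReal_biUnion_finset_le _ _
    _ ≤ (∑ s ∈ Finset.range (C + 1), 2 ^ s.choose 2) * Fintype.card V ^ (-η) := by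
        rw [Finset.sum_mul]
        exact Finset.sum_le_sum fun s _ => binomialRandom_real_exists_card_endpoints_eq_le hp η s

theorem tendsto_exists_card_endpoints_le {p : ℕ → I} {y η : ℝ} (hη : 0 < η)
    (hp : ∀ᶠ n : ℕ in atTop, (p n : ℝ) ≤ (n : ℝ) ^ (-y)) (C : ℕ) :
    Tendsto (fun n : ℕ => (binomialRandom (Fin n) (p n)).real
      {G | ∃ F : Finset (Sym2 (Fin n)), ↑F ⊆ G.edgeSet ∧ (endpoints F).card ≤ C ∧
        copyExponent y F ≤ -η}) atTop (𝓝 0) := by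
  have hlim : Tendsto (fun n : ℕ => (∑ s ∈ Finset.range (C + 1), (2 : ℝ) ^ s.choose 2) *
      (n : ℝ) ^ (-η)) atTop (𝓝 0) := by
    simpa using ((tendsto_rpow_neg_atTop hη).comp tendsto_natCast_atTop_atTop).const_mul _
  refine squeeze_zero' (Eventually.of_forall fun _ => measureReal_nonneg) ?_ hlim
  filter_upwards [hp, eventually_ge_atTop 1] with n hpn hn
  have : NeZero n := ⟨by omega⟩
  simpa using binomialRandom_real_exists_card_endpoints_le (V := Fin n) (by simpa using hpn) η C

end FirstMoment

section CliqueCount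

open unitInterval SimpleGraph

theorem nonempty_top_iso_coe_iff {V W : Type*} {G : SimpleGraph V} (G' : G.Subgraph) :
    Nonempty ((⊤ : SimpleGraph W) ≃g G'.coe) ↔
      ∃ s : Set V, G.IsClique s ∧ Nonempty (W ≃ s) ∧ (⊤ : G.Subgraph).induce s = G' := by
  constructor
  · rintro ⟨f⟩
    have hadj {a b : V} (ha : a ∈ G'.verts) (hb : b ∈ G'.verts) (hab : a ≠ b) : G'.Adj a b :=
      (f.symm.map_adj_iff (v := ⟨a, ha⟩) (w := ⟨b, hb⟩)).1
        (f.symm.injective.ne (Subtype.coe_ne_coe.1 hab))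
    refine ⟨G'.verts, fun a ha b hb hab => (hadj ha hb hab).adj_sub, ⟨f.toEquiv⟩, ?_⟩
    ext a b
    · rfl
    · exact ⟨fun ⟨ha, hb, h⟩ => hadj ha hb h.ne,
        fun h => ⟨G'.edge_vert h, G'.edge_vert h.symm, h.adj_sub⟩⟩
  · rintro ⟨s, hs, ⟨f⟩, rfl⟩
    rw [← induce_eq_coe_induce_top, induce_eq_top.2 hs]
    exact ⟨Iso.completeGraph f⟩

theorem copyCount_top_eq_ncard_cliqueSet {V : Type*} [Fintype V] (m : ℕ) (G : SimpleGraph V) :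
    G.copyCount (⊤ : SimpleGraph (Fin m)) = (G.cliqueSet m).ncard := by
  classical
  have hinj : Function.Injective fun K : Finset V => (⊤ : G.Subgraph).induce (K : Set V) :=
    fun _ _ h => Finset.coe_injective (congrArg Subgraph.verts h)
  rw [copyCount, ← Set.ncard_coe_finset, ← Set.ncard_image_of_injective _ hinj]
  congr 1
  ext G'
  rw [Finset.mem_coe, Finset.mem_filter_univ, nonempty_top_iso_coe_iff]
  constructor
  · rintro ⟨s, hs, ⟨f⟩, rfl⟩
    refine ⟨s.toFinset, ⟨by rwa [Set.coe_toFinset], ?_⟩, by simp only [Set.coe_toFinset]⟩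
    rw [Set.toFinset_card, ← Fintype.card_congr f, Fintype.card_fin]
  · rintro ⟨K, hK, rfl⟩
    exact ⟨K, hK.isClique, ⟨(K.equivFinOfCardEq hK.card_eq).symm⟩, rfl⟩

theorem maxCopies_top_eq_ncard_cliqueSet {U V : Type*} [Fintype U] {m : ℕ} {H : SimpleGraph V}
    {G : SimpleGraph U} (hfree : H.Free (cliqueGraph m G)) :
    maxCopies G (⊤ : SimpleGraph (Fin m)) H = (G.cliqueSet m).ncard := by
  classical
  refine le_antisymm (Finset.sup_le fun G' hG' => ?_) ?_
  · rw [copyCount_top_eq_ncard_cliqueSet]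
    exact Set.ncard_le_ncard fun K hK => hK.mono (Finset.mem_filter.1 hG').2.1
  · have hcliques : G.cliqueSet m = (cliqueGraph m G).cliqueSet m :=
      Set.ext fun K => isNClique_cliqueGraph_iff.symm
    rw [hcliques, ← copyCount_top_eq_ncard_cliqueSet, maxCopies]
    refine Finset.le_sup (f := fun G' : SimpleGraph U => G'.copyCount (⊤ : SimpleGraph (Fin m))) ?_
    exact Finset.mem_filter.2 ⟨@Finset.mem_univ _ (_) _, cliqueGraph_le m G, hfree⟩

/-- The expected number of cliques of size `m` in `G(N, p)`. -/
def expectedCliques (N m : ℕ) (p : ℝ) : ℝ := N.choose m * p ^ m.choose 2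

section Overlap

variable {V : Type*} [DecidableEq V]

theorem pow_card_completeEdges_union {p : ℝ} (hp : p ≠ 0) (S T : Finset V) :
    p ^ (completeEdges S ∪ completeEdges T).card =
      p ^ S.card.choose 2 * p ^ T.card.choose 2 * (p ^ (S ∩ T).card.choose 2)⁻¹ := by
  rw [← div_eq_mul_inv, eq_div_iff (pow_ne_zero _ hp), ← pow_add, ← pow_add,
    ← card_completeEdges (S ∩ T), ← completeEdges_inter, Finset.card_union_add_card_inter,
    card_completeEdges, card_completeEdges]

theorem sum_choose_card_inter [Fintype V] (S : Finset V) {n k : ℕ} (hkn : k ≤ n) :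
    ∑ T ∈ Finset.univ.powersetCard n, (S ∩ T).card.choose k =
      S.card.choose k * (Fintype.card V - k).choose (n - k) := by
  have hpowersetCard (T : Finset V) :
      (S ∩ T).card.choose k = ((S.powersetCard k).filter (· ⊆ T)).card := by
    rw [← Finset.card_powersetCard]
    congr 1
    ext A
    simp only [Finset.mem_powersetCard, Finset.mem_filter, Finset.subset_inter_iff]
    tauto
  calc _ = ∑ T ∈ Finset.univ.powersetCard n, ((S.powersetCard k).filter (· ⊆ T)).card :=
        Finset.sum_congr rfl fun T _ => hpowersetCard T
    _ = ∑ A ∈ S.powersetCard k, ((Finset.univ.powersetCard n).filter (A ⊆ ·)).card := by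
        simp only [Finset.card_filter]
        exact Finset.sum_comm
    _ = _ := by
        rw [← Finset.card_powersetCard, ← smul_eq_mul]
        refine Finset.sum_eq_card_nsmul fun A hA => ?_
        have hAk := (Finset.mem_powersetCard.1 hA).2
        rw [Finset.card_filter_powersetCard_subset _ _ _ A.subset_univ (hAk ▸ hkn), hAk,
          Finset.card_univ]

theorem inv_pow_choose_two_le {p : ℝ} (hp : 0 ≤ p) {j m : ℕ} (hjm : j ≤ m) :
    (p ^ j.choose 2)⁻¹ ≤ 1 + ∑ k ∈ Finset.Icc 2 m, (j.choose k : ℝ) * (p ^ k.choose 2)⁻¹ := by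
  obtain hsmall | hlarge := lt_or_ge j 2
  · rw [Nat.choose_eq_zero_of_lt hsmall, pow_zero, inv_one]
    exact le_add_of_nonneg_right (Finset.sum_nonneg fun k _ => by positivity)
  · calc (p ^ j.choose 2)⁻¹ = (j.choose j : ℝ) * (p ^ j.choose 2)⁻¹ := by simp
      _ ≤ ∑ k ∈ Finset.Icc 2 m, (j.choose k : ℝ) * (p ^ k.choose 2)⁻¹ :=
          Finset.single_le_sum (f := fun k => (j.choose k : ℝ) * (p ^ k.choose 2)⁻¹)
            (fun k _ => by positivity) (Finset.mem_Icc.2 ⟨hlarge, hjm⟩)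
      _ ≤ _ := le_add_of_nonneg_left zero_le_one

theorem choose_mul_inv_pow_eq {N m k : ℕ} (hkm : k ≤ m) (hmN : m ≤ N) (p : ℝ) :
    ((m.choose k * (N - k).choose (m - k) : ℕ) : ℝ) * (p ^ k.choose 2)⁻¹ =
      N.choose m * ((m.choose k : ℝ) ^ 2 / expectedCliques N k p) := by
  have hchoose : (N.choose m : ℝ) * m.choose k = N.choose k * (N - k).choose (m - k) := by
    exact_mod_cast Nat.choose_mul hkm
  have hpos : (N.choose k : ℝ) ≠ 0 := Nat.cast_ne_zero.2 (Nat.choose_pos (hkm.trans hmN)).ne'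
  rw [expectedCliques, ← div_div, div_eq_mul_inv _ (p ^ k.choose 2), Nat.cast_mul, ← mul_assoc]
  congr 1
  field_simp
  linear_combination -(m.choose k : ℝ) * hchoose

theorem sum_inv_pow_choose_card_inter_le [Fintype V] {p : ℝ} (hp : 0 ≤ p) (S : Finset V) :
    ∑ T ∈ Finset.univ.powersetCard S.card, (p ^ (S ∩ T).card.choose 2)⁻¹ ≤
      (Fintype.card V).choose S.card * (1 + ∑ k ∈ Finset.Icc 2 S.card,
        (S.card.choose k : ℝ) ^ 2 / expectedCliques (Fintype.card V) k p) := by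
  calc _ ≤ ∑ T ∈ Finset.univ.powersetCard S.card, (1 + ∑ k ∈ Finset.Icc 2 S.card,
          ((S ∩ T).card.choose k : ℝ) * (p ^ k.choose 2)⁻¹) :=
        Finset.sum_le_sum fun T _ =>
          inv_pow_choose_two_le hp (Finset.card_le_card Finset.inter_subset_left)
    _ = _ := by
        rw [Finset.sum_add_distrib, Finset.sum_const, Finset.card_powersetCard, nsmul_one,
          Finset.card_univ, mul_one_add, Finset.sum_comm, Finset.mul_sum]
        congr 1
        refine Finset.sum_congr rfl fun k hk => ?_
        have hkS := (Finset.mem_Icc.1 hk).2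
        rw [← Finset.sum_mul, ← Nat.cast_sum, sum_choose_card_inter S hkS,
          choose_mul_inv_pow_eq hkS S.card_le_univ]

end Overlap

variable {V : Type*} [Fintype V] {m : ℕ}

theorem ncard_cliqueSet_eq_sum [DecidableEq V] (G : SimpleGraph V) :
    ((G.cliqueSet m).ncard : ℝ) =
      ∑ S ∈ Finset.univ.powersetCard m, (containing (completeEdges S)).indicator 1 G := by
  classical
  have hcliques : G.cliqueSet m = ((Finset.univ.powersetCard m).filter fun S =>
      G ∈ containing (completeEdges S) : Finset (Finset V)) := by
    ext S
    rw [Finset.mem_coe, Finset.mem_filter, Finset.mem_powersetCard_univ, mem_cliqueSet_iff,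
      isNClique_iff, containing, Set.mem_ofPred_eq, coe_completeEdges_subset_iff, and_comm]
  simp only [hcliques, Set.ncard_coe_finset, Set.indicator_apply, Pi.one_apply, Finset.sum_boole]

theorem integral_ncard_cliqueSet (p : I) :
    ∫ G, ((G.cliqueSet m).ncard : ℝ) ∂binomialRandom V p =
      expectedCliques (Fintype.card V) m p := by
  classical
  simp only [ncard_cliqueSet_eq_sum]
  rw [integral_finsetSum _ fun _ _ => Integrable.of_finite, expectedCliques, ← nsmul_eq_mul,
    ← Finset.card_univ, ← Finset.card_powersetCard]
  refine Finset.sum_eq_card_nsmul fun S hS => ?_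
  rw [integral_indicator_one MeasurableSet.of_discrete,
    binomialRandom_real_containing p fun _ => not_isDiag_of_mem_completeEdges,
    card_completeEdges, Finset.mem_powersetCard_univ.1 hS]

theorem integral_ncard_cliqueSet_sq [DecidableEq V] (p : I) :
    ∫ G, ((G.cliqueSet m).ncard : ℝ) ^ 2 ∂binomialRandom V p =
      ∑ S ∈ Finset.univ.powersetCard m, ∑ T ∈ Finset.univ.powersetCard m,
        (p : ℝ) ^ (completeEdges S ∪ completeEdges T : Finset (Sym2 V)).card := by
  simp only [ncard_cliqueSet_eq_sum, sq, Finset.sum_mul_sum]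
  rw [integral_finsetSum _ fun _ _ => Integrable.of_finite]
  refine Finset.sum_congr rfl fun S _ => ?_
  rw [integral_finsetSum _ fun _ _ => Integrable.of_finite]
  refine Finset.sum_congr rfl fun T _ => ?_
  have hinter : containing (completeEdges S) ∩ containing (completeEdges T) =
      containing (completeEdges S ∪ completeEdges T) := by
    ext G
    simp [containing]
  have hdiag : ∀ e ∈ completeEdges S ∪ completeEdges T, ¬ e.IsDiag := fun e he =>
    (Finset.mem_union.1 he).elim not_isDiag_of_mem_completeEdges not_isDiag_of_mem_completeEdges
  rw [← binomialRandom_real_containing p hdiag, ← hinter,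
    ← integral_indicator_one MeasurableSet.of_discrete, Set.inter_indicator_one]
  rfl

theorem variance_ncard_cliqueSet_le {p : I} (hp : p ≠ 0) :
    ProbabilityTheory.variance (fun G => ((G.cliqueSet m).ncard : ℝ)) (binomialRandom V p) ≤
      expectedCliques (Fintype.card V) m p ^ 2 * ∑ k ∈ Finset.Icc 2 m,
        (m.choose k : ℝ) ^ 2 / expectedCliques (Fintype.card V) k p := by
  classical
  set N := Fintype.card V
  set r := ∑ k ∈ Finset.Icc 2 m, (m.choose k : ℝ) ^ 2 / expectedCliques N k p
  have hinner (S : Finset V) (hS : S ∈ Finset.univ.powersetCard m) :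
      ∑ T ∈ Finset.univ.powersetCard m,
        (p : ℝ) ^ (completeEdges S ∪ completeEdges T : Finset (Sym2 V)).card ≤
      (p : ℝ) ^ m.choose 2 * (expectedCliques N m p * (1 + r)) := by
    obtain rfl := Finset.mem_powersetCard_univ.1 hS
    calc _ = ∑ T ∈ Finset.univ.powersetCard S.card, (p : ℝ) ^ S.card.choose 2 *
          (p : ℝ) ^ S.card.choose 2 * ((p : ℝ) ^ (S ∩ T).card.choose 2)⁻¹ := by
          refine Finset.sum_congr rfl fun T hT => ?_
          rw [pow_card_completeEdges_union (unitInterval.coe_ne_zero.2 hp),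
            Finset.mem_powersetCard_univ.1 hT]
      _ ≤ (p : ℝ) ^ S.card.choose 2 * (p : ℝ) ^ S.card.choose 2 *
          (N.choose S.card * (1 + r)) := by
          rw [← Finset.mul_sum]
          exact mul_le_mul_of_nonneg_left (sum_inv_pow_choose_card_inter_le p.2.1 S)
            (mul_nonneg (pow_nonneg p.2.1 _) (pow_nonneg p.2.1 _))
      _ = _ := by
          rw [expectedCliques]
          ring
  rw [ProbabilityTheory.variance_eq_sub MemLp.of_discrete]
  simp only [Pi.pow_apply]
  rw [integral_ncard_cliqueSet, integral_ncard_cliqueSet_sq, sub_le_iff_le_add]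
  calc _ ≤ N.choose m • ((p : ℝ) ^ m.choose 2 * (expectedCliques N m p * (1 + r))) := by
        have hcard : (Finset.univ.powersetCard m : Finset (Finset V)).card = N.choose m :=
          Finset.card_powersetCard m Finset.univ
        exact hcard ▸ Finset.sum_le_card_nsmul _ _ _ hinner
    _ = expectedCliques N m p ^ 2 * r + expectedCliques N m p ^ 2 := by
        rw [nsmul_eq_mul, expectedCliques]
        ring

end CliqueCount

section Concentration

open unitInterval SimpleGraph

theorem choose_two_mul_le {k m : ℕ} (hkm : k ≤ m) : k.choose 2 * m ≤ m.choose 2 * k := by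
  have hcast : ((k.choose 2 * m : ℕ) : ℝ) ≤ ((m.choose 2 * k : ℕ) : ℝ) := by
    have hkm' : (k : ℝ) ≤ m := by exact_mod_cast hkm
    push_cast
    rw [Nat.cast_choose_two, Nat.cast_choose_two]
    nlinarith [mul_nonneg (mul_nonneg k.cast_nonneg m.cast_nonneg) (sub_nonneg.2 hkm')]
  exact_mod_cast hcast

theorem tendsto_expectedCliques_iff {p : ℕ → I} {m : ℕ} :
    Tendsto (fun n => expectedCliques n m (p n)) atTop atTop ↔
      Tendsto (fun n : ℕ => (n : ℝ) ^ m * (p n : ℝ) ^ m.choose 2) atTop atTop := by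
  have htheta := (isTheta_choose m).mul
    (Asymptotics.isTheta_refl (fun n => (p n : ℝ) ^ m.choose 2) atTop)
  convert htheta.tendsto_norm_atTop_iff using 2 <;> ext n <;>
    exact (Real.norm_of_nonneg
      (mul_nonneg (by positivity) (pow_nonneg (p n).2.1 _))).symm

/- `(n ^ k * p ^ (k choose 2)) ^ (1 / k) = n * p ^ ((k - 1) / 2)` is nonincreasing in `k`. -/
theorem tendsto_expectedCliques_of_le {p : ℕ → I} {k m : ℕ} (hk : k ≠ 0) (hkm : k ≤ m)
    (h : Tendsto (fun n => expectedCliques n m (p n)) atTop atTop) :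
    Tendsto (fun n => expectedCliques n k (p n)) atTop atTop := by
  rw [tendsto_expectedCliques_iff] at h ⊢
  refine tendsto_atTop.2 fun B => ?_
  filter_upwards [((tendsto_pow_atTop hk).comp h).eventually_ge_atTop (|B| ^ m)] with n hn
  have hp := (p n).2
  have hpow : |B| ^ m ≤ ((n : ℝ) ^ k * (p n : ℝ) ^ k.choose 2) ^ m :=
    calc |B| ^ m ≤ ((n : ℝ) ^ m * (p n : ℝ) ^ m.choose 2) ^ k := hn
      _ = (n : ℝ) ^ (k * m) * (p n : ℝ) ^ (m.choose 2 * k) := by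
        rw [mul_pow, ← pow_mul, ← pow_mul, mul_comm m k]
      _ ≤ (n : ℝ) ^ (k * m) * (p n : ℝ) ^ (k.choose 2 * m) :=
        mul_le_mul_of_nonneg_left (pow_le_pow_of_le_one hp.1 hp.2 (choose_two_mul_le hkm))
          (by positivity)
      _ = _ := by rw [mul_pow, ← pow_mul, ← pow_mul]
  exact (le_abs_self B).trans (le_of_pow_le_pow_left₀ (by omega)
    (mul_nonneg (by positivity) (pow_nonneg hp.1 _)) hpow)

theorem binomialRandom_real_lt_abs_ncard_cliqueSet_sub_le {V : Type*} [Fintype V] {m : ℕ} {p : I}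
    {ε : ℝ} (hε : 0 < ε) (hp : p ≠ 0) (hE : 0 < expectedCliques (Fintype.card V) m p) :
    (binomialRandom V p).real {G | ε * expectedCliques (Fintype.card V) m p <
      |((G.cliqueSet m).ncard : ℝ) - expectedCliques (Fintype.card V) m p|} ≤
      (∑ k ∈ Finset.Icc 2 m, (m.choose k : ℝ) ^ 2 / expectedCliques (Fintype.card V) k p) /
        ε ^ 2 := by
  set X : SimpleGraph V → ℝ := fun G => (G.cliqueSet m).ncard
  have hchebyshev := ProbabilityTheory.meas_ge_le_variance_div_sq (μ := binomialRandom V p)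
    (X := X) MemLp.of_discrete (mul_pos hε hE)
  rw [integral_ncard_cliqueSet] at hchebyshev
  set E := expectedCliques (Fintype.card V) m p
  calc (binomialRandom V p).real {G | ε * E < |X G - E|}
      ≤ (binomialRandom V p).real {G | ε * E ≤ |X G - E|} :=
        measureReal_mono (fun G (hG : ε * E < |X G - E|) => hG.le) (measure_ne_top _ _)
    _ ≤ ProbabilityTheory.variance X (binomialRandom V p) / (ε * E) ^ 2 :=
        ENNReal.toReal_le_of_le_ofReal
          (div_nonneg (ProbabilityTheory.variance_nonneg _ _) (sq_nonneg _)) hchebyshev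
    _ ≤ _ := by
        rw [div_le_iff₀ (by positivity)]
        refine (variance_ncard_cliqueSet_le hp).trans_eq ?_
        field_simp
        exact mul_comm _ _

variable {p : ℕ → I} {X Y : ∀ n : ℕ, SimpleGraph (Fin n) → ℝ} {f : ℕ → ℝ}

theorem whpAsymp_iff_tendsto_zero :
    WhpAsymp p X f ↔ ∀ ε : ℝ, 0 < ε → Tendsto (fun n : ℕ => (binomialRandom (Fin n) (p n)).real
      {G | ε * f n < |X n G - f n|}) atTop (𝓝 0) := by
  refine forall₂_congr fun ε _ => ?_
  have hcompl (n : ℕ) : (binomialRandom (Fin n) (p n)).real {G | |X n G - f n| ≤ ε * f n} =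
      1 - (binomialRandom (Fin n) (p n)).real {G | ε * f n < |X n G - f n|} := by
    rw [← probReal_compl_eq_one_sub MeasurableSet.of_discrete, Set.compl_ofPred]
    simp only [not_lt]
  simp only [hcompl]
  refine ⟨fun h => ?_, fun h => ?_⟩
  · simpa using h.const_sub 1
  · simpa using h.const_sub 1

theorem WhpAsymp.congr_whp (h : WhpAsymp p X f)
    (hXY : Tendsto (fun n : ℕ => (binomialRandom (Fin n) (p n)).real {G | X n G ≠ Y n G})
      atTop (𝓝 0)) : WhpAsymp p Y f := by
  rw [whpAsymp_iff_tendsto_zero] at h ⊢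
  intro ε hε
  have hsum := (h ε hε).add hXY
  rw [add_zero] at hsum
  refine squeeze_zero (fun _ => measureReal_nonneg) (fun n => ?_) hsum
  refine (measureReal_mono (fun G hG => ?_) (measure_ne_top _ _)).trans (measureReal_union_le _ _)
  by_cases hG' : X n G = Y n G
  · exact Or.inl (by rwa [Set.mem_ofPred_eq, hG'])
  · exact Or.inr hG'

theorem whpAsymp_ncard_cliqueSet {m : ℕ} (hm : 2 ≤ m)
    (h : Tendsto (fun n => expectedCliques n m (p n)) atTop atTop) :
    WhpAsymp p (fun _ G => ((G.cliqueSet m).ncard : ℝ)) fun n => expectedCliques n m (p n) := by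
  rw [whpAsymp_iff_tendsto_zero]
  intro ε hε
  have hlim : Tendsto (fun n => (∑ k ∈ Finset.Icc 2 m, (m.choose k : ℝ) ^ 2 /
      expectedCliques n k (p n)) / ε ^ 2) atTop (𝓝 0) := by
    rw [← zero_div (ε ^ 2), ← Finset.sum_const_zero (s := Finset.Icc 2 m)]
    refine (tendsto_finsetSum _ fun k hk => ?_).div_const _
    obtain ⟨h2, hkm⟩ := Finset.mem_Icc.1 hk
    exact (tendsto_expectedCliques_of_le (by omega) hkm h).const_div_atTop _
  refine squeeze_zero' (Eventually.of_forall fun _ => measureReal_nonneg) ?_ hlim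
  filter_upwards [h.eventually_gt_atTop 0] with n hn
  have hp : p n ≠ 0 := by
    intro hp
    simp [expectedCliques, hp, (Nat.choose_pos hm).ne'] at hn
  have hbound := binomialRandom_real_lt_abs_ncard_cliqueSet_sub_le (V := Fin n) hε hp
    (by rwa [Fintype.card_fin])
  rwa [Fintype.card_fin] at hbound

end Concentration

end RandomTuran

theorem theorem1p4_general (m : ℕ) (hm : 3 ≤ m) (c : ℝ)
    (hc : c < RandomTuran.twoDensity (⊤ : SimpleGraph (Fin m))) :
    ∃ (M : ℕ) (δ : ℝ), 0 < δ ∧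
      ∀ (V : Type*) [Fintype V] (H : SimpleGraph V),
        H.edgeSet.Nontrivial →
        RandomTuran.twoDensity H < c →
        (∃ H₀ : H.Subgraph,
          ((H₀.edgeSet.ncard : ℝ) - 1) / ((H₀.verts.ncard : ℝ) - 2) = RandomTuran.twoDensity H ∧
          M < H₀.verts.ncard) →
        ∀ p : ℕ → unitInterval,
          (∀ᶠ n : ℕ in atTop, (p n : ℝ) ≤ (n : ℝ) ^ (-1 / RandomTuran.twoDensity H + δ)) →
          Tendsto (fun n : ℕ => (n.choose m : ℝ) * (p n : ℝ) ^ (m.choose 2)) atTop atTop →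
          RandomTuran.WhpAsymp p
            (fun n G => (RandomTuran.maxCopies G (⊤ : SimpleGraph (Fin m)) H : ℝ))
            (fun n => (n.choose m : ℝ) * (p n : ℝ) ^ (m.choose 2)) := by
  obtain ⟨M, δ, hδ, hdense⟩ := RandomTuran.exists_copyExponent_le_neg_one hm
    (hc.trans_le (RandomTuran.twoDensity_completeGraph_le (by omega)))
  refine ⟨M, δ, hδ, fun V _ H hH hHc hH₀ p hp hE => ?_⟩
  have hp' : ∀ᶠ n : ℕ in atTop, (p n : ℝ) ≤ (n : ℝ) ^ (-(1 / RandomTuran.twoDensity H - δ)) := by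
    simpa only [neg_sub, neg_div, neg_add_eq_sub] using hp
  refine (RandomTuran.whpAsymp_ncard_cliqueSet (by omega) hE).congr_whp ?_
  refine squeeze_zero (fun _ => measureReal_nonneg) (fun n => ?_)
    (RandomTuran.tendsto_exists_card_endpoints_le one_pos hp' (Fintype.card (Sym2 V) * m))
  refine measureReal_mono (fun G hG => ?_) (measure_ne_top _ _)
  refine hdense V H hH hHc hH₀ (Fin n) G fun hfree => hG ?_
  rw [RandomTuran.maxCopies_top_eq_ncard_cliqueSet hfree]

theorem theorem1p4 (m : ℕ) (hm : 4 ≤ m + 1) (c : ℝ)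
    (hc : c < RandomTuran.twoDensity (⊤ : SimpleGraph (Fin m))) :
    ∃ (M : ℕ) (δ : ℝ), 0 < δ ∧
      ∀ (V : Type*) [Fintype V] (H : SimpleGraph V),
        H.chromaticNumber = ((m + 1 : ℕ) : ℕ∞) →
        RandomTuran.twoDensity H < c →
        (∃ H₀ : H.Subgraph,
          ((H₀.edgeSet.ncard : ℝ) - 1) / ((H₀.verts.ncard : ℝ) - 2) = RandomTuran.twoDensity H ∧
          M < H₀.verts.ncard) →
        ∀ p : ℕ → unitInterval,
          (∀ᶠ n : ℕ in atTop, (p n : ℝ) ≤ (n : ℝ) ^ (-1 / RandomTuran.twoDensity H + δ)) →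
          Tendsto (fun n : ℕ => (n.choose m : ℝ) * (p n : ℝ) ^ (m.choose 2)) atTop atTop →
          RandomTuran.WhpAsymp p
            (fun n G => (RandomTuran.maxCopies G (⊤ : SimpleGraph (Fin m)) H : ℝ))
            (fun n => (n.choose m : ℝ) * (p n : ℝ) ^ (m.choose 2)) := by
  obtain ⟨M, δ, hδ, h⟩ := theorem1p4_general m (by omega) c hc
  exact ⟨M, δ, hδ, fun V _ H hχ =>
    h V H (RandomTuran.edgeSet_nontrivial_of_two_lt_chromaticNumber (by rw [hχ]; norm_cast; omega))⟩
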